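/- **Setting.** Let $F_1,\dots,F_N:\mathbb{R}^d\to\mathbb{R}$ be twice differentiable, let $R=\frac1N\sum_{i=1}^N F_i$ be twice continuously differentiable, and let $w^*$ be a minimizer of $R$. Norms are the $\ell_2$ norm and the induced matrix norm; $A\preceq B$ means that $B-A$ is symmetric positive semidefinite. Fix one of the two modes of sampling indices from $\{1,\dots,N\}$, with or without replacement. A sample $S$ of size $n\ge 1$ is a list of $n$ indices, required to be distinct if sampling is without replacement, and $\nabla^2R_S(w)=\frac1n\sum_{i\in S}\nabla^2F_i(w)$ (counted with multiplicity). Assume: * (A1) There are positive constants $\mu_n,L_n$ ($n\ge1$), $\bar\mu,\bar L$ and $\mu,L$ such that $\mu_n I\preceq\nabla^2R_S(w)\preceq L_n I$ for every $w$ and every sample $S$ of size $n$, with $\bar\mu\le\mu_n$ and $L_n\le\bar L$ for all $n\ge1$, and $\mu I\preceq\nabla^2R(w)\preceq L I$ for all $w$. * (A3) There is $M>0$ with $\|\nabla^2R(w)-\nabla^2R(z)\|\le M\|w-z\|$ for all $w,z$. * (A4) There is $\sigma$ with $\bigl\|\frac1N\sum_{i=1}^N(\nabla^2F_i(w)-\nabla^2R(w))^2\bigr\|\le\sigma^2$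 for all $w$. **Method.** Let $\beta\ge1$ and $r\ge1$ be integers, let $S_0,S_1,\dots$ be independent random samples of size $\beta$, each uniformly distributed over all samples of size $\beta$, let $w_0\in\mathbb{R}^d$ be deterministic, and let $w_{k+1}=w_k+p_k^r$, where $p_k^r$ is the result of $r$ steps of the conjugate gradient method, started at $0$, for the linear system $\nabla^2R_{S_k}(w_k)\,p=-\nabla R(w_k)$ (the iterate stays fixed once the residual vanishes). Assume: * (B1) There is $\gamma>0$ with $\mathbb{E}[\|w_k-w^*\|^2]\le\gamma\,(\mathbb{E}[\|w_k-w^*\|])^2$ for all $k\ge0$. **Theorem 3.2.** Put $\delta=L_\beta/\mu_\beta$ and $C_1=M/(2\mu_\beta)$. Suppose that $$\beta\ge\frac{64\sigma^2}{\bar\mu^2}\qquad\text{and, if }\delta\ne1,\qquad r\ \ge\ \log\Bigl(\frac{16L}{\mu_\beta}\sqrt{\delta}\Bigr)\,\frac{1}{\log\Bigl(\frac{\sqrt{\delta}+1}{\sqrt{\delta}-1}\Bigr)}$$ (if $\delta=1$ there is no condition on $r$ besides $r\ge1$). If $$\|w_0-w^*\|\le\min\Bigl\{\frac1{4C_1},\frac1{4\gamma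 C_1}\Bigr\},$$ then for every $k\ge0$ the random variable $\|w_k-w^*\|$ is integrable and $$\mathbb{E}[\|w_{k+1}-w^*\|]\le\tfrac12\,\mathbb{E}[\|w_k-w^*\|].$$ -/

import Mathlib

open MeasureTheory ProbabilityTheory

namespace SubsampledNewton

/-- The space `ℝ^d` with the `ℓ²` norm. Its continuous linear endomorphisms carry the induced
operator norm and the Loewner order (`A ≤ B` iff `B - A` is symmetric positive semidefinite). -/
abbrev Vec (d : ℕ) : Type := EuclideanSpace ℝ (Fin d)

/-- The Hessian of `f` at `w`, as the linear operator `D(∇f)(w)`. -/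
noncomputable def hess {d : ℕ} (f : Vec d → ℝ) (w : Vec d) : Vec d →L[ℝ] Vec d :=
  fderiv ℝ (gradient f) w

/-- The empirical risk `R(w) = (1/N) ∑ᵢ Fᵢ(w)`. -/
noncomputable def risk {d N : ℕ} (F : Fin N → Vec d → ℝ) (w : Vec d) : ℝ :=
  (N : ℝ)⁻¹ * ∑ i, F i w

/-- The subsampled Hessian `∇²R_S(w) = (1/β) ∑_{i ∈ S} ∇²Fᵢ(w)` of a sample `S` of size `β`, given
as the list of the `β` drawn indices. -/
noncomputable def sampleHess {d N β : ℕ} (F : Fin N → Vec d → ℝ) (S : Fin β → Fin N)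
    (w : Vec d) : Vec d →L[ℝ] Vec d :=
  (β : ℝ)⁻¹ • ∑ j, hess (F (S j)) w

/-- The two ways of drawing a sample of indices. -/
inductive Sampling
  | withReplacement
  | withoutReplacement

/-- The samples of size `β` that can be drawn: all lists of `β` indices when sampling with
replacement, and the lists of `β` distinct indices (sets of size `β`) when sampling without. -/
def samples (mode : Sampling) (β N : ℕ) : Set (Fin β → Fin N) :=
  match mode with
  | .withReplacement => Set.univ
  | .withoutReplacement => {S | Function.Injective S}

/-- `S₀, S₁, …` are independent random samples of size `β`, each uniformly distributed over the
samples that can be drawn. -/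
structure IsSampleSequence {Ω : Type*} [MeasurableSpace Ω] (P : Measure Ω) (mode : Sampling)
    {β N : ℕ} (S : ℕ → Ω → Fin β → Fin N) : Prop where
  measurable : ∀ k, Measurable (S k)
  law : ∀ k, P.map (S k) = uniformOn (samples mode β N)
  indep : iIndepFun S P

/-- Bounded eigenvalues of the Hessians: `μs n I ⪯ ∇²R_S(w) ⪯ Ls n I` for every sample `S` of size
`n ≥ 1`, with `0 < μbar ≤ μs n` and `Ls n ≤ Lbar`, and `μ I ⪯ ∇²R(w) ⪯ L I`. -/
structure BoundedHessians {d N : ℕ} (F : Fin N → Vec d → ℝ) (mode : Sampling)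
    (μs Ls : ℕ → ℝ) (μbar Lbar μ L : ℝ) : Prop where
  differentiable : ∀ i, Differentiable ℝ (F i)
  differentiable_gradient : ∀ i, Differentiable ℝ (gradient (F i))
  contDiff_risk : ContDiff ℝ 2 (risk F)
  pos : ∀ n, 1 ≤ n → 0 < μs n ∧ 0 < Ls n
  le_sampleHess : ∀ n, 1 ≤ n → ∀ S ∈ samples mode n N, ∀ w,
    μs n • ContinuousLinearMap.id ℝ (Vec d) ≤ sampleHess F S w
  sampleHess_le : ∀ n, 1 ≤ n → ∀ S ∈ samples mode n N, ∀ w,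
    sampleHess F S w ≤ Ls n • ContinuousLinearMap.id ℝ (Vec d)
  μbar_pos : 0 < μbar
  μbar_le : ∀ n, 1 ≤ n → μbar ≤ μs n
  le_Lbar : ∀ n, 1 ≤ n → Ls n ≤ Lbar
  μ_pos : 0 < μ
  L_pos : 0 < L
  le_hess : ∀ w, μ • ContinuousLinearMap.id ℝ (Vec d) ≤ hess (risk F) w
  hess_le : ∀ w, hess (risk F) w ≤ L • ContinuousLinearMap.id ℝ (Vec d)

/-- The Hessian of the objective is Lipschitz continuous with constant `M > 0`. -/
def LipschitzHessian {d : ℕ} (f : Vec d → ℝ) (M : ℝ) : Prop :=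
  0 < M ∧ ∀ w z, ‖hess f w - hess f z‖ ≤ M * ‖w - z‖

/-- Bounded variance of the component Hessians: `‖𝔼ᵢ[(∇²Fᵢ(w) - ∇²R(w))²]‖ ≤ σ²`, for an index `i`
drawn uniformly from the `N` components. -/
def BoundedHessianVariance {d N : ℕ} (F : Fin N → Vec d → ℝ) (σ : ℝ) : Prop :=
  ∀ w, ‖(N : ℝ)⁻¹ • ∑ i, (hess (F i) w - hess (risk F) w) ^ 2‖ ≤ σ ^ 2

/-- State of the conjugate gradient iteration: iterate, residual, search direction. -/
structure CGState (d : ℕ) where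
  x : Vec d
  res : Vec d
  dir : Vec d

/-- One conjugate gradient step for the matrix `A`. Once the residual is zero the quotients below
are `0 / 0 = 0`, so the iterate no longer changes: the method has terminated. -/
noncomputable def cgStep {d : ℕ} (A : Vec d →L[ℝ] Vec d) (s : CGState d) : CGState d :=
  let a : ℝ := inner ℝ s.res s.res / inner ℝ s.dir (A s.dir)
  let res' : Vec d := s.res - a • A s.dir
  let b : ℝ := inner ℝ res' res' / inner ℝ s.res s.res
  { x := s.x + a • s.dir
    res := res'
    dir := res' + b • s.dir }

/-- The result of `r` conjugate gradient steps for `A p = b`, started at `p = 0`. -/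
noncomputable def cg {d : ℕ} (A : Vec d →L[ℝ] Vec d) (b : Vec d) (r : ℕ) : Vec d :=
  ((cgStep A)^[r] { x := 0, res := b, dir := b }).x

/-- The iterates of the inexact Newton-CG method for the samples `S 0, S 1, …`:
`w_{k+1} = w_k + p_k`, where `p_k` is obtained by `r` conjugate gradient steps on
`∇²R_{S_k}(w_k) p = -∇R(w_k)`. -/
noncomputable def newtonCG {d N β : ℕ} (F : Fin N → Vec d → ℝ) (r : ℕ) (w₀ : Vec d)
    (S : ℕ → Fin β → Fin N) : ℕ → Vec d
  | 0 => w₀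
  | k + 1 =>
    newtonCG F r w₀ S k +
      cg (sampleHess F (S k) (newtonCG F r w₀ S k))
        (-gradient (risk F) (newtonCG F r w₀ S k)) r

/-- Bounded moments of the errors of the random iterates `w k`:
`𝔼‖w_k - w⋆‖² ≤ γ (𝔼‖w_k - w⋆‖)²` for all `k`, where `γ > 0`. -/
def BoundedMoments {Ω : Type*} [MeasurableSpace Ω] (P : Measure Ω) {d : ℕ}
    (w : ℕ → Ω → Vec d) (wstar : Vec d) (γ : ℝ) : Prop :=
  0 < γ ∧ ∀ k, ∫ ω, ‖w k ω - wstar‖ ^ 2 ∂P ≤ γ * (∫ ω, ‖w k ω - wstar‖ ∂P) ^ 2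

end SubsampledNewton

/-! Write `e = w - w*`, `H = ∇²R(w)`, and let `A` be the subsampled Hessian. The exact step `p`,
with `A p = -∇R(w)`, satisfies `A (w + p - w*) = (A - H) e - (∇R(w) - H e)`. As `A ⪰ μ_β I` and
`∇R(w*) = 0`, Taylor's bound makes its error at most `‖(A - H) e‖ / μ_β + C₁ ‖e‖²`. Two further
errors are each made at most `‖e‖ / 8`, the second in the mean.

Conjugate gradients: the iterate minimizes the energy norm of the error over a Krylov space
(`cg_energy_le`), so any polynomial with value one at zero gives a bound. The Chebyshev one
(`exists_polynomial_small`) decays geometrically, and the condition on `r` is the resulting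
threshold (`norm_sub_cg_le`).

Sampling: `(A - H) e` is an average of sampled centred vectors `(∇²F_i - H) e` whose mean square is
at most `σ² ‖e‖²`. Distinct draws are nonpositively correlated in both modes
(`sum_samples_inner_nonpos`), so the mean norm is at most `σ ‖e‖ / √β ≤ μbar ‖e‖ / 8`.

Since `S_k` is independent of `w_k`, averaging and (B1) give `a_{k+1} ≤ C₁ γ a_k² + a_k / 4` for
`a_k = 𝔼‖w_k - w*‖`. While `a_k ≤ 1 / (4 γ C₁)` the right side is at most `a_k / 2`, which preserves
that bound. -/

namespace SubsampledNewton

open scoped InnerProductSpace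
open Polynomial (aeval eval X C)

/-! ### Krylov spaces and optimality of conjugate gradients -/

/-- The Krylov space `span {b, A b, …, A^{k-1} b}`. -/
def krylov {d : ℕ} (A : Vec d →L[ℝ] Vec d) (b : Vec d) : ℕ → Submodule ℝ (Vec d)
  | 0 => ⊥
  | k + 1 => Submodule.span ℝ {b} ⊔ (krylov A b k).map (A : Vec d →ₗ[ℝ] Vec d)

section Krylov

variable {d : ℕ} {A : Vec d →L[ℝ] Vec d} {b : Vec d}

lemma mem_krylov_succ_self (k : ℕ) : b ∈ krylov A b (k + 1) :=
  Submodule.mem_sup_left (Submodule.mem_span_singleton_self b)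

lemma map_mem_krylov_succ {k : ℕ} {y : Vec d} (hy : y ∈ krylov A b k) :
    A y ∈ krylov A b (k + 1) :=
  Submodule.mem_sup_right (Submodule.mem_map_of_mem hy)

lemma krylov_le_succ (k : ℕ) : krylov A b k ≤ krylov A b (k + 1) := by
  induction k with
  | zero => exact bot_le
  | succ k ih => exact sup_le_sup le_rfl (Submodule.map_mono ih)

/-- Horner's scheme: `q = X * q.divX + q(0)` matches the recursion of the Krylov spaces. -/
lemma aeval_mem_krylov (k : ℕ) (q : Polynomial ℝ) (hq : q.degree < k) :
    aeval A q b ∈ krylov A b k := by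
  induction k generalizing q with
  | zero =>
    have : q = 0 := by
      rw [← Polynomial.degree_eq_bot]
      exact Nat.WithBot.lt_zero_iff.mp (by simpa using hq)
    simp [this]
  | succ k ih =>
    have hdiv : q.divX.degree < k := by
      by_cases h0 : q = 0
      · simp [h0]
      · have := Polynomial.degree_divX_lt h0
        rcases eq_or_ne q.divX 0 with h | h
        · simp [h]
        · rw [Polynomial.degree_eq_natDegree h] at *
          rw [Polynomial.degree_eq_natDegree h0] at *
          norm_cast at *
          omega
    rw [← Polynomial.divX_mul_X_add q, mul_comm]
    have h : aeval A (X * q.divX + C (q.coeff 0)) b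
        = A (aeval A q.divX b) + q.coeff 0 • b := by
      rw [map_add, map_mul, Polynomial.aeval_X, Polynomial.aeval_C,
        Algebra.algebraMap_eq_smul_one]
      rfl
    rw [h]
    exact Submodule.add_mem _ (map_mem_krylov_succ (ih _ hdiv))
      (Submodule.smul_mem _ _ (mem_krylov_succ_self k))

/-- The state of the conjugate gradient iteration after `k` steps from zero. -/
noncomputable def cgState {d : ℕ} (A : Vec d →L[ℝ] Vec d) (b : Vec d) (k : ℕ) : CGState d :=
  (cgStep A)^[k] { x := 0, res := b, dir := b }

/-- The invariants of the conjugate gradient iteration. -/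
structure CGInvariant {d : ℕ} (A : Vec d →L[ℝ] Vec d) (b : Vec d) (k : ℕ) (s : CGState d) :
    Prop where
  res_eq : s.res = b - A s.x
  x_mem : s.x ∈ krylov A b k
  orthogonal : ∀ y ∈ krylov A b k, ⟪s.res, y⟫_ℝ = 0
  res_mem : s.res ≠ 0 → s.res ∈ krylov A b (k + 1)
  dir_sub_mem : s.res ≠ 0 → s.dir - s.res ∈ krylov A b k
  conjugate : s.res ≠ 0 → ∀ y ∈ krylov A b k, ⟪s.dir, A y⟫_ℝ = 0
  krylov_le : s.res ≠ 0 → krylov A b (k + 1) ≤ krylov A b k ⊔ Submodule.span ℝ {s.dir}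

/-- The next Krylov space lies in the sum of the current one and the line of the search direction.
So the new orthogonality and conjugacy need checking only on the old space, where they are
inherited, and on the old direction, where the two step coefficients enforce them. After termination
the direction becomes zero, hence the guards `s.res ≠ 0`. -/
lemma CGInvariant.step (hA : ∀ x y, ⟪A x, y⟫_ℝ = ⟪x, A y⟫_ℝ)
    (hpos : ∀ x, x ≠ 0 → 0 < ⟪x, A x⟫_ℝ) {k : ℕ} {s : CGState d} (h : CGInvariant A b k s) :
    CGInvariant A b (k + 1) (cgStep A s) := by
  by_cases h0 : s.res = 0
  · have hres : (cgStep A s).res = 0 := by simp [cgStep, h0]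
    have hx : (cgStep A s).x = s.x := by simp [cgStep, h0]
    refine ⟨?_, ?_, ?_, fun h => (h hres).elim, fun h => (h hres).elim, fun h => (h hres).elim,
      fun h => (h hres).elim⟩
    · rw [hres, hx, ← h.res_eq, h0]
    · rw [hx]; exact krylov_le_succ k h.x_mem
    · simp [hres]
  · obtain ⟨x, ρ, p⟩ := s
    simp only at h0
    have hres := h.res_eq
    have hx := h.x_mem
    have horth := h.orthogonal
    have hmem := h.res_mem h0
    have hdir := h.dir_sub_mem h0
    have hconj := h.conjugate h0
    have hle := h.krylov_le h0
    simp only at hres hx horth hmem hdir hconj hle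
    have hpmem : p ∈ krylov A b (k + 1) := by
      have := Submodule.add_mem _ (krylov_le_succ k hdir) hmem
      simpa using this
    have hrr : 0 < ⟪ρ, ρ⟫_ℝ := real_inner_self_pos.mpr h0
    have hrp : ⟪ρ, p⟫_ℝ = ⟪ρ, ρ⟫_ℝ := by
      have := horth _ hdir
      rw [inner_sub_right] at this
      linarith
    have hp0 : p ≠ 0 := by
      rintro rfl
      rw [inner_zero_right] at hrp
      exact hrr.ne hrp
    have hpp := hpos p hp0
    set a : ℝ := ⟪ρ, ρ⟫_ℝ / ⟪p, A p⟫_ℝ with ha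
    have ha0 : 0 < a := div_pos hrr hpp
    have hap : a * ⟪p, A p⟫_ℝ = ⟪ρ, ρ⟫_ℝ := div_mul_cancel₀ _ hpp.ne'
    set ρ' : Vec d := ρ - a • A p with hρ'
    set c : ℝ := ⟪ρ', ρ'⟫_ℝ / ⟪ρ, ρ⟫_ℝ with hc
    have hcr : c * ⟪ρ, ρ⟫_ℝ = ⟪ρ', ρ'⟫_ℝ := div_mul_cancel₀ _ hrr.ne'
    have hstep : cgStep A ⟨x, ρ, p⟩ = ⟨x + a • p, ρ', ρ' + c • p⟩ := rfl
    rw [hstep]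
    have hAp : a • A p = ρ - ρ' := by rw [hρ']; abel
    have horth' : ∀ y ∈ krylov A b (k + 1), ⟪ρ', y⟫_ℝ = 0 := by
      intro y hy
      obtain ⟨u, hu, v, hv, rfl⟩ := Submodule.mem_sup.mp (hle hy)
      obtain ⟨t, rfl⟩ := Submodule.mem_span_singleton.mp hv
      have h1 : ⟪ρ', u⟫_ℝ = 0 := by
        rw [hρ', inner_sub_left, inner_smul_left, hA, horth u hu, hconj u hu]
        simp
      have h2 : ⟪ρ', p⟫_ℝ = 0 := by
        rw [hρ', inner_sub_left, inner_smul_left, hA, hrp]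
        simp [hap]
      rw [inner_add_right, inner_smul_right, h1, h2]
      simp
    have hρ'mem : ρ' ∈ krylov A b (k + 2) :=
      Submodule.sub_mem _ (krylov_le_succ _ hmem)
        (Submodule.smul_mem _ _ (map_mem_krylov_succ hpmem))
    refine ⟨?_, ?_, horth', fun _ => hρ'mem, fun _ => ?_, fun _ => ?_, fun _ => ?_⟩
    · simp only [map_add, map_smul, hρ', hres]
      abel
    · exact Submodule.add_mem _ (krylov_le_succ k hx) (Submodule.smul_mem _ _ hpmem)
    · simpa using Submodule.smul_mem _ c hpmem
    · intro y hy
      obtain ⟨u, hu, v, hv, rfl⟩ := Submodule.mem_sup.mp (hle hy)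
      obtain ⟨t, rfl⟩ := Submodule.mem_span_singleton.mp hv
      have h1 : ⟪ρ' + c • p, A u⟫_ℝ = 0 := by
        rw [inner_add_left, inner_smul_left, hconj u hu, horth' _ (map_mem_krylov_succ hu)]
        simp
      have h2 : ⟪ρ' + c • p, A p⟫_ℝ = 0 := by
        -- Here `a • A p = ρ - ρ'` and `ρ' ⟂ ρ`; the coefficient `c` cancels the remaining `-‖ρ'‖²`.
        have h3 : a * ⟪ρ', A p⟫_ℝ = - ⟪ρ', ρ'⟫_ℝ := by
          rw [← inner_smul_right, hAp, inner_sub_right, horth' ρ hmem]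
          simp
        have h4 : a * ⟪ρ' + c • p, A p⟫_ℝ = 0 := by
          rw [inner_add_left, real_inner_smul_left, mul_add, h3, ← hcr, ← hap]
          ring
        exact (mul_eq_zero.mp h4).resolve_left ha0.ne'
      rw [map_add, map_smul, inner_add_right, inner_smul_right, h1, h2]
      simp
    · change Submodule.span ℝ {b} ⊔ (krylov A b (k + 1)).map (A : Vec d →ₗ[ℝ] Vec d) ≤ _
      refine sup_le ?_ ?_
      · rw [Submodule.span_singleton_le_iff_mem]
        exact Submodule.mem_sup_left (mem_krylov_succ_self k)
      · rw [Submodule.map_le_iff_le_comap]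
        refine hle.trans (sup_le ?_ ?_)
        · intro u hu
          exact Submodule.mem_sup_left (map_mem_krylov_succ hu)
        · rw [Submodule.span_singleton_le_iff_mem, Submodule.mem_comap]
          -- The only new vector `A p` is split into an element of the current Krylov space and a
          -- multiple of the new direction.
          have h5 : A p = a⁻¹ • (ρ + c • p) - a⁻¹ • (ρ' + c • p) := by
            rw [← smul_sub, add_sub_add_right_eq_sub, ← hAp, inv_smul_smul₀ ha0.ne']
          rw [ContinuousLinearMap.coe_coe, h5]
          refine Submodule.sub_mem _ (Submodule.mem_sup_left ?_) (Submodule.mem_sup_right ?_)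
          · exact Submodule.smul_mem _ _
              (Submodule.add_mem _ hmem (Submodule.smul_mem _ _ hpmem))
          · exact Submodule.smul_mem _ _ (Submodule.mem_span_singleton_self _)

lemma cgInvariant (hA : ∀ x y, ⟪A x, y⟫_ℝ = ⟪x, A y⟫_ℝ)
    (hpos : ∀ x, x ≠ 0 → 0 < ⟪x, A x⟫_ℝ) (k : ℕ) : CGInvariant A b k (cgState A b k) := by
  induction k with
  | zero =>
    refine ⟨?_, ?_, ?_, fun _ => ?_, fun _ => ?_, fun _ => ?_, fun _ => ?_⟩ <;>
      simp [cgState, krylov, Submodule.mem_span_singleton_self]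
  | succ k ih =>
    rw [cgState, Function.iterate_succ_apply']
    exact ih.step hA hpos

/-- The conjugate gradient iterate minimizes the energy norm of the error over the Krylov space. -/
lemma cg_energy_le (hA : ∀ x y, ⟪A x, y⟫_ℝ = ⟪x, A y⟫_ℝ)
    (hpos : ∀ x, x ≠ 0 → 0 < ⟪x, A x⟫_ℝ) {k : ℕ} {p : Vec d} (hp : A p = b) {y : Vec d}
    (hy : y ∈ krylov A b k) :
    ⟪p - cg A b k, A (p - cg A b k)⟫_ℝ ≤ ⟪p - y, A (p - y)⟫_ℝ := by
  have h := cgInvariant (b := b) hA hpos k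
  have hcg : (cgState A b k).x = cg A b k := rfl
  have hres : (cgState A b k).res = A (p - cg A b k) := by
    rw [h.res_eq, map_sub, hp, hcg]
  set e := p - cg A b k
  set z := cg A b k - y with hz
  have hzmem : z ∈ krylov A b k := Submodule.sub_mem _ h.x_mem hy
  have h0 : ⟪A e, z⟫_ℝ = 0 := by rw [← hres]; exact h.orthogonal z hzmem
  have h1 : p - y = e + z := by simp [e, hz]
  have hzz : 0 ≤ ⟪z, A z⟫_ℝ := by
    rcases eq_or_ne z 0 with hz0 | hz0
    · simp [hz0]
    · exact (hpos z hz0).le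
  have h2 : ⟪e, A z⟫_ℝ = 0 := by rw [← hA, h0]
  have h3 : ⟪z, A e⟫_ℝ = 0 := by rw [real_inner_comm, h0]
  rw [h1, map_add, inner_add_left, inner_add_right, inner_add_right, h2, h3]
  linarith

/-- A polynomial in a symmetric operator is bounded in the energy norm by its values on the
spectrum. -/
lemma energy_aeval_le (hA : ∀ x y, ⟪A x, y⟫_ℝ = ⟪x, A y⟫_ℝ) {m L K : ℝ} (hm : 0 ≤ m)
    (hlow : ∀ x, m * ‖x‖ ^ 2 ≤ ⟪x, A x⟫_ℝ) (hup : ∀ x, ⟪x, A x⟫_ℝ ≤ L * ‖x‖ ^ 2)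
    (q : Polynomial ℝ) (hq : ∀ t, m ≤ t → t ≤ L → |eval t q| ≤ K) (x : Vec d) :
    ⟪aeval A q x, A (aeval A q x)⟫_ℝ ≤ K ^ 2 * ⟪x, A x⟫_ℝ := by
  have hsym : (A : Vec d →ₗ[ℝ] Vec d).IsSymmetric := hA
  have hn : Module.finrank ℝ (Vec d) = d := by simp
  -- In an orthonormal eigenbasis `q(A)` multiplies the coordinates by `q(l i)`, and the energy is a
  -- weighted sum of their squares.
  set e := hsym.eigenvectorBasis hn
  set l := hsym.eigenvalues hn
  have hAe : ∀ i, A (e i) = l i • e i := fun i => hsym.apply_eigenvectorBasis hn i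
  have hle : ∀ i, l i = ⟪e i, A (e i)⟫_ℝ := by
    intro i
    rw [hAe, inner_smul_right, real_inner_self_eq_norm_sq, e.orthonormal.1 i]
    simp
  have hml : ∀ i, m ≤ l i := fun i => by
    have := hlow (e i)
    rwa [← hle, e.orthonormal.1 i, one_pow, mul_one] at this
  have hlL : ∀ i, l i ≤ L := fun i => by
    have := hup (e i)
    rwa [← hle, e.orthonormal.1 i, one_pow, mul_one] at this
  have hAinner : ∀ i z, ⟪e i, A z⟫_ℝ = l i * ⟪e i, z⟫_ℝ := fun i z => by
    rw [← hA, hAe, real_inner_smul_left]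
  have henergy : ∀ z, ⟪z, A z⟫_ℝ = ∑ i, l i * ⟪e i, z⟫_ℝ ^ 2 := fun z => by
    rw [← e.sum_inner_mul_inner]
    refine Finset.sum_congr rfl fun i _ => ?_
    rw [hAinner, real_inner_comm]
    ring
  have hqinner : ∀ (q : Polynomial ℝ) i z, ⟪e i, aeval A q z⟫_ℝ = eval (l i) q * ⟪e i, z⟫_ℝ := by
    intro q i z
    induction q using Polynomial.induction_on' with
    | add p q hp hq => simp [inner_add_right, hp, hq, add_mul]
    | monomial n a =>
      have hpow : ∀ n : ℕ, ⟪e i, (A ^ n) z⟫_ℝ = l i ^ n * ⟪e i, z⟫_ℝ := by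
        intro n
        induction n with
        | zero => simp
        | succ n ih =>
          rw [pow_succ', mul_apply_eq_comp, hAinner, ih]
          ring
      rw [Polynomial.aeval_monomial, Algebra.algebraMap_eq_smul_one, smul_one_mul,
        smul_apply, inner_smul_right, hpow, Polynomial.eval_monomial, mul_assoc]
  rw [henergy, henergy, Finset.mul_sum]
  refine Finset.sum_le_sum fun i _ => ?_
  rw [hqinner, mul_pow]
  have h1 : eval (l i) q ^ 2 ≤ K ^ 2 := by
    rw [← sq_abs]
    exact pow_le_pow_left₀ (abs_nonneg _) (hq _ (hml i) (hlL i)) 2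
  have h2 : 0 ≤ l i * ⟪e i, x⟫_ℝ ^ 2 := mul_nonneg (hm.trans (hml i)) (sq_nonneg _)
  calc l i * (eval (l i) q ^ 2 * ⟪e i, x⟫_ℝ ^ 2)
      = eval (l i) q ^ 2 * (l i * ⟪e i, x⟫_ℝ ^ 2) := by ring
    _ ≤ K ^ 2 * (l i * ⟪e i, x⟫_ℝ ^ 2) := mul_le_mul_of_nonneg_right h1 h2

/-- Conjugate gradient error bound from a polynomial that is one at zero. -/
lemma norm_sub_cg_le_of_polynomial (hA : ∀ x y, ⟪A x, y⟫_ℝ = ⟪x, A y⟫_ℝ) {m L K : ℝ} (hm : 0 < m)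
    (hK : 0 ≤ K)
    (hlow : ∀ x, m * ‖x‖ ^ 2 ≤ ⟪x, A x⟫_ℝ) (hup : ∀ x, ⟪x, A x⟫_ℝ ≤ L * ‖x‖ ^ 2)
    {k : ℕ} (q : Polynomial ℝ) (hdeg : q.natDegree ≤ k) (hq0 : eval 0 q = 1)
    (hq : ∀ t, m ≤ t → t ≤ L → |eval t q| ≤ K) {p : Vec d} (hp : A p = b) :
    ‖cg A b k - p‖ ≤ K * √(L / m) * ‖p‖ := by
  have hpos : ∀ x, x ≠ 0 → 0 < ⟪x, A x⟫_ℝ := fun x hx =>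
    (mul_pos hm (pow_pos (norm_pos_iff.mpr hx) 2)).trans_le (hlow x)
  have hdivX : q.divX.degree < k := by
    rcases eq_or_ne q.divX 0 with h | h
    · simp [h]
    · have hne : q.natDegree ≠ 0 := by
        intro h0
        rw [Polynomial.eq_C_of_natDegree_eq_zero h0] at h
        simp at h
      rw [Polynomial.degree_eq_natDegree h, Polynomial.natDegree_divX_eq_natDegree_tsub_one]
      norm_cast
      omega
  -- Because `q(0) = 1` and `A p = b`, the vector `q(A) p` is the error of the Krylov competitor
  -- `-q.divX(A) b`.
  have hsplit : p + aeval A q.divX b = aeval A q p := by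
    have hc : q.coeff 0 = 1 := by rw [Polynomial.coeff_zero_eq_eval_zero, hq0]
    conv_rhs => rw [← Polynomial.divX_mul_X_add q, hc]
    simp [hp, add_comm]
  have hen := cg_energy_le hA hpos hp
    (Submodule.neg_mem _ (aeval_mem_krylov (A := A) (b := b) k q.divX hdivX))
  rw [sub_neg_eq_add, hsplit] at hen
  have h1 := hen.trans (energy_aeval_le hA hm.le hlow hup q hq p)
  have h2 := (hlow (p - cg A b k)).trans h1
  have h3 : m * ‖p - cg A b k‖ ^ 2 ≤ K ^ 2 * (L * ‖p‖ ^ 2) :=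
    h2.trans (mul_le_mul_of_nonneg_left (hup p) (sq_nonneg K))
  -- The square root needs `0 ≤ L`, which only a nonzero vector provides.
  rcases eq_or_ne p 0 with hp0 | hp0
  · rw [hp0] at h3 ⊢
    have : ‖(0 : Vec d) - cg A b k‖ ^ 2 ≤ 0 := by
      by_contra! hcon
      have := mul_pos hm hcon
      simp at h3
      simp at this
      linarith
    have h4 : ‖(0 : Vec d) - cg A b k‖ = 0 := by
      have := le_antisymm this (sq_nonneg _)
      exact pow_eq_zero_iff two_ne_zero |>.mp this
    rw [norm_sub_rev, h4]
    simp
  · have hL : 0 ≤ L := by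
      have := (hpos p hp0).trans_le (hup p)
      exact (pos_of_mul_pos_left this (sq_nonneg _)).le
    rw [norm_sub_rev]
    refine le_of_sq_le_sq ?_ (by positivity)
    rw [mul_pow, mul_pow, Real.sq_sqrt (by positivity)]
    rw [mul_comm, ← le_div_iff₀ hm] at h3
    calc _ ≤ _ := h3
      _ = _ := by ring

end Krylov

/-! ### Chebyshev polynomials and the convergence rate -/

lemma pow_div_two_le_eval_T {z : ℝ} (hz : 0 < z) (k : ℕ) :
    z ^ k / 2 ≤ eval ((z + z⁻¹) / 2) (Polynomial.Chebyshev.T ℝ k) := by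
  -- With `t = log z` the value is `T_k(cosh t) = cosh(k t) ≥ exp(k t) / 2`.
  have h : (z + z⁻¹) / 2 = Real.cosh (Real.log z) := by
    rw [Real.cosh_log hz]
  have h2 : z ^ k = Real.exp ((k : ℤ) * Real.log z) := by
    rw [Int.cast_natCast, Real.exp_nat_mul, Real.exp_log hz]
  rw [h, Polynomial.Chebyshev.T_real_cosh, h2, Real.cosh_eq]
  have := Real.exp_pos (-((k : ℤ) * Real.log z))
  linarith

/-- The shifted and scaled Chebyshev polynomial, which is one at zero and small on `[m, L]`. -/
lemma exists_polynomial_small {m L : ℝ} (hm : 0 < m) (hmL : m < L) (k : ℕ) :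
    ∃ q : Polynomial ℝ, q.natDegree ≤ k ∧ eval 0 q = 1 ∧
      ∀ t, m ≤ t → t ≤ L → |eval t q| ≤ 2 * ((√(L / m) - 1) / (√(L / m) + 1)) ^ k := by
  have hLm : 0 < L - m := sub_pos.mpr hmL
  set s := √(L / m) with hs
  have hs1 : 1 < s := by
    rw [hs, Real.lt_sqrt zero_le_one, one_pow]
    exact (one_lt_div hm).mpr hmL
  have hs2 : s ^ 2 = L / m := Real.sq_sqrt (div_pos (hm.trans hmL) hm).le
  have hL : L = s ^ 2 * m := by rw [hs2, div_mul_cancel₀ _ hm.ne']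
  -- The affine map sending `m` to `1` and `L` to `-1` sends `0` to `(L + m) / (L - m)`, which is
  -- `(z + z⁻¹) / 2` for this `z`.
  set z := (s + 1) / (s - 1) with hz
  have hz0 : 0 < z := div_pos (by linarith) (by linarith)
  have hsm : s - 1 ≠ 0 := by linarith
  have hsp : s + 1 ≠ 0 := by linarith
  have hzz : (z + z⁻¹) / 2 = (L + m) / (L - m) := by
    have h1 : L - m = m * ((s - 1) * (s + 1)) := by rw [hL]; ring
    rw [hz, inv_div, h1, hL]
    field_simp
    ring
  have hinv : (s - 1) / (s + 1) = z⁻¹ := by rw [hz, inv_div]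
  set τ := eval ((L + m) / (L - m)) (Polynomial.Chebyshev.T ℝ k) with hτ
  have hτ1 : z ^ k / 2 ≤ τ := by
    rw [hτ, ← hzz]
    exact pow_div_two_le_eval_T hz0 k
  have hτ0 : 0 < τ := (by positivity : 0 < z ^ k / 2).trans_le hτ1
  refine ⟨C τ⁻¹ * (Polynomial.Chebyshev.T ℝ k).comp
    (C (-2 / (L - m)) * X + C ((L + m) / (L - m))), ?_, ?_, ?_⟩
  · refine (Polynomial.natDegree_C_mul_le _ _).trans (Polynomial.natDegree_comp_le.trans ?_)
    rw [Polynomial.Chebyshev.natDegree_T, Int.natAbs_natCast]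
    calc _ ≤ k * 1 := Nat.mul_le_mul_left _ Polynomial.natDegree_linear_le
      _ = k := mul_one k
  · rw [Polynomial.eval_mul, Polynomial.eval_comp]
    simp only [Polynomial.eval_C, Polynomial.eval_add, Polynomial.eval_mul, Polynomial.eval_X,
      mul_zero, zero_add]
    exact inv_mul_cancel₀ hτ0.ne'
  · intro t hmt htL
    rw [Polynomial.eval_mul, Polynomial.eval_comp, abs_mul]
    simp only [Polynomial.eval_C, Polynomial.eval_add, Polynomial.eval_mul, Polynomial.eval_X]
    have harg : |-2 / (L - m) * t + (L + m) / (L - m)| ≤ 1 := by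
      have h1 : -2 / (L - m) * t + (L + m) / (L - m) = (L + m - 2 * t) / (L - m) := by ring
      rw [h1, abs_div, abs_of_pos hLm, div_le_one hLm, abs_le]
      constructor <;> linarith
    have hT := Polynomial.Chebyshev.abs_eval_T_real_le_one k harg
    rw [abs_of_pos (inv_pos.mpr hτ0), hinv]
    calc τ⁻¹ * _ ≤ τ⁻¹ * 1 := mul_le_mul_of_nonneg_left hT (inv_pos.mpr hτ0).le
      _ ≤ (z ^ k / 2)⁻¹ := by
        rw [mul_one]
        exact inv_anti₀ (by positivity) hτ1
      _ = 2 * z⁻¹ ^ k := by rw [inv_div, inv_pow, div_eq_mul_inv]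

/-- The conjugate gradient error bound for condition number `L / m`, once the number of steps
exceeds the logarithmic threshold for the accuracy `1 / y`. -/
lemma norm_sub_cg_le {d : ℕ} {A : Vec d →L[ℝ] Vec d} {b : Vec d}
    (hA : ∀ x y, ⟪A x, y⟫_ℝ = ⟪x, A y⟫_ℝ) {m L y : ℝ} (hm : 0 < m) (hmL : m ≤ L) (hy : 0 < y)
    (hlow : ∀ x, m * ‖x‖ ^ 2 ≤ ⟪x, A x⟫_ℝ) (hup : ∀ x, ⟪x, A x⟫_ℝ ≤ L * ‖x‖ ^ 2)
    {k : ℕ} (hk : 1 ≤ k)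
    (hlog : L / m ≠ 1 →
      Real.log y * (1 / Real.log ((√(L / m) + 1) / (√(L / m) - 1))) ≤ (k : ℝ))
    {p : Vec d} (hp : A p = b) :
    ‖cg A b k - p‖ ≤ 2 / y * √(L / m) * ‖p‖ := by
  rcases hmL.eq_or_lt with rfl | hlt
  -- For `L = m` the polynomial `1 - t / m` vanishes at the only eigenvalue, so one step is exact.
  · refine norm_sub_cg_le_of_polynomial hA hm (by positivity) hlow hup
      (C (-m⁻¹) * X + C 1) (Polynomial.natDegree_linear_le.trans hk) (by simp) ?_ hp
    intro t h1 h2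
    obtain rfl : t = m := le_antisymm h2 h1
    have : eval t (C (-t⁻¹) * X + C 1) = 0 := by
      simp [hm.ne']
    rw [this, abs_zero]
    positivity
  · obtain ⟨q, hq1, hq2, hq3⟩ := exists_polynomial_small hm hlt k
    refine norm_sub_cg_le_of_polynomial hA hm (by positivity) hlow hup q hq1 hq2
      (fun t h1 h2 => (hq3 t h1 h2).trans ?_) hp
    have hκ : 1 < L / m := (one_lt_div hm).mpr hlt
    have hs1 : 1 < √(L / m) := by rwa [Real.lt_sqrt zero_le_one, one_pow]
    set s := √(L / m)
    have hz1 : 1 < (s + 1) / (s - 1) := by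
      rw [one_lt_div (by linarith)]
      linarith
    have hz0 := zero_lt_one.trans hz1
    have h := hlog hκ.ne'
    rw [mul_one_div, div_le_iff₀ (Real.log_pos hz1), ← Real.log_pow,
      Real.log_le_log_iff hy (by positivity)] at h
    rw [← inv_div (s + 1), inv_pow, div_eq_mul_inv 2 y]
    exact mul_le_mul_of_nonneg_left (inv_anti₀ hy h) zero_le_two

/-! ### Second moments of uniform samples -/

section SamplingVariance

variable {E : Type*} [NormedAddCommGroup E] [InnerProductSpace ℝ E]

lemma comp_mem_samples {mode : Sampling} {β N : ℕ} (π : Equiv.Perm (Fin N))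
    {S : Fin β → Fin N} : π ∘ S ∈ samples mode β N ↔ S ∈ samples mode β N := by
  cases mode
  · simp [samples]
  · exact π.injective.of_comp_iff S

open Classical in
lemma sum_samples_comp {M : Type*} [AddCommMonoid M] {mode : Sampling} {β N : ℕ}
    (π : Equiv.Perm (Fin N)) (g : (Fin β → Fin N) → M) :
    ∑ S ∈ (samples mode β N).toFinset, g (π ∘ S) = ∑ S ∈ (samples mode β N).toFinset, g S := by
  refine Finset.sum_equiv ((Equiv.refl (Fin β)).arrowCongr π) (fun S => ?_) (fun S _ => ?_)
  · simp only [Set.mem_toFinset]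
    exact (comp_mem_samples π).symm
  · rfl

-- Each draw is marginally uniform: averaged over the cyclic shifts of `Fin N`, the entry `S j` runs
-- through all indices. Without division, an empty set of samples needs no exception.
open Classical in
lemma card_mul_sum_samples_apply {mode : Sampling} {β N : ℕ} (f : Fin N → ℝ) (j : Fin β) :
    (N : ℝ) * ∑ S ∈ (samples mode β N).toFinset, f (S j)
      = (samples mode β N).toFinset.card * ∑ i, f i := by
  rcases Nat.eq_zero_or_pos N with rfl | hN
  · simp
  have : NeZero N := ⟨hN.ne'⟩
  calc (N : ℝ) * ∑ S ∈ (samples mode β N).toFinset, f (S j)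
      = ∑ c : Fin N, ∑ S ∈ (samples mode β N).toFinset, f (S j + c) := by
        have h : ∀ c : Fin N, ∑ S ∈ (samples mode β N).toFinset, f (S j + c)
            = ∑ S ∈ (samples mode β N).toFinset, f (S j) :=
          fun c => sum_samples_comp (Equiv.addRight c) (fun S => f (S j))
        rw [Finset.sum_congr rfl fun c _ => h c]
        simp
    _ = ∑ S ∈ (samples mode β N).toFinset, ∑ i, f i := by
        rw [Finset.sum_comm]
        exact Finset.sum_congr rfl fun S _ => Equiv.sum_comp (Equiv.addLeft (S j)) f
    _ = _ := by simp

/-- Swapping `b` with another index shows that the sum is the same for every `b ≠ a`. As `∑ i, X i =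
0`, these equal sums add up to `-∑ π, ‖X (π a)‖²`. -/
lemma sum_perm_inner_nonpos {ι : Type*} [Fintype ι] [DecidableEq ι] {X : ι → E}
    (hX : ∑ i, X i = 0) {a b : ι} (hab : a ≠ b) :
    ∑ π : Equiv.Perm ι, ⟪X (π a), X (π b)⟫_ℝ ≤ 0 := by
  set G : ι → ℝ := fun b => ∑ π : Equiv.Perm ι, ⟪X (π a), X (π b)⟫_ℝ with hG
  have hconst : ∀ b' ∈ Finset.univ.erase a, G b' = G b := by
    intro b' hb'
    have hb'a : a ≠ b' := (Finset.ne_of_mem_erase hb').symm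
    refine Fintype.sum_equiv (Equiv.mulRight (Equiv.swap b b')) _ _ fun π => ?_
    simp [Equiv.swap_apply_of_ne_of_ne hab hb'a]
  have hsum : ∑ b' ∈ Finset.univ.erase a, G b' ≤ 0 := by
    rw [hG, Finset.sum_comm]
    refine Finset.sum_nonpos fun π _ => ?_
    rw [← inner_sum]
    have h1 : ∑ i, X (π i) = 0 := by rw [Equiv.sum_comp π X, hX]
    rw [← Finset.add_sum_erase _ _ (Finset.mem_univ a)] at h1
    rw [eq_neg_of_add_eq_zero_right h1, inner_neg_right, neg_nonpos]
    exact real_inner_self_nonneg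
  rw [Finset.sum_congr rfl hconst, Finset.sum_const, nsmul_eq_mul] at hsum
  have hcard : (0 : ℝ) < (Finset.univ.erase a).card := by
    exact_mod_cast Finset.card_pos.mpr ⟨b, Finset.mem_erase.mpr ⟨hab.symm, Finset.mem_univ b⟩⟩
  exact nonpos_of_mul_nonpos_right hsum hcard

-- With replacement, shifting the entry `l` alone averages `X (S l)` to zero. Without replacement,
-- averaging over relabellings reduces to a sum over permutations.
open Classical in
lemma sum_samples_inner_nonpos {mode : Sampling} {β N : ℕ} {X : Fin N → E}
    (hX : ∑ i, X i = 0) {j l : Fin β} (hjl : j ≠ l) :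
    ∑ S ∈ (samples mode β N).toFinset, ⟪X (S j), X (S l)⟫_ℝ ≤ 0 := by
  rcases Nat.eq_zero_or_pos N with rfl | hN
  · exact Finset.sum_nonpos fun S _ => (S j).elim0
  have : NeZero N := ⟨hN.ne'⟩
  cases mode with
  | withReplacement =>
    have hshift : ∀ c : Fin N, ∑ S : Fin β → Fin N, ⟪X (S j), X (S l + c)⟫_ℝ
        = ∑ S : Fin β → Fin N, ⟪X (S j), X (S l)⟫_ℝ := by
      intro c
      let e : (Fin β → Fin N) ≃ (Fin β → Fin N) :=
        Equiv.piCongrRight fun i => if i = l then Equiv.addRight c else Equiv.refl _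
      refine Fintype.sum_equiv e _ _ fun S => ?_
      simp [e, hjl]
    have hN' : (0 : ℝ) < N := by exact_mod_cast hN
    have hzero : (N : ℝ) * ∑ S : Fin β → Fin N, ⟪X (S j), X (S l)⟫_ℝ = 0 := by
      calc (N : ℝ) * ∑ S : Fin β → Fin N, ⟪X (S j), X (S l)⟫_ℝ
          = ∑ c : Fin N, ∑ S : Fin β → Fin N, ⟪X (S j), X (S l + c)⟫_ℝ := by
            rw [Finset.sum_congr rfl fun c _ => hshift c]
            simp
        _ = 0 := by
            rw [Finset.sum_comm]
            refine Finset.sum_eq_zero fun S _ => ?_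
            have h : ∑ c, X (S l + c) = 0 := (Equiv.sum_comp (Equiv.addLeft (S l)) X).trans hX
            rw [← inner_sum, h, inner_zero_right]
    have hs : (samples .withReplacement β N).toFinset = Finset.univ := by
      ext S
      simp only [Set.mem_toFinset, Finset.mem_univ, iff_true]
      trivial
    rw [hs]
    exact ((mul_eq_zero.mp hzero).resolve_left hN'.ne').le
  | withoutReplacement =>
    set s := (samples .withoutReplacement β N).toFinset
    have hN' : (0 : ℝ) < (Fintype.card (Equiv.Perm (Fin N)) : ℝ) := by
      exact_mod_cast Fintype.card_pos
    have h : (Fintype.card (Equiv.Perm (Fin N)) : ℝ) * ∑ S ∈ s, ⟪X (S j), X (S l)⟫_ℝ ≤ 0 := by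
      calc _ = ∑ π : Equiv.Perm (Fin N), ∑ S ∈ s, ⟪X (π (S j)), X (π (S l))⟫_ℝ := by
            have h : ∀ π : Equiv.Perm (Fin N), ∑ S ∈ s, ⟪X (π (S j)), X (π (S l))⟫_ℝ
                = ∑ S ∈ s, ⟪X (S j), X (S l)⟫_ℝ :=
              fun π => sum_samples_comp π (fun S => ⟪X (S j), X (S l)⟫_ℝ)
            rw [Finset.sum_congr rfl fun π _ => h π]
            simp
        _ ≤ 0 := by
            rw [Finset.sum_comm]
            refine Finset.sum_nonpos fun S hS => sum_perm_inner_nonpos hX ?_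
            have hinj : Function.Injective S := Set.mem_toFinset.mp hS
            exact hinj.ne hjl
    exact nonpos_of_mul_nonpos_right h hN'

open Classical in
/-- The second moment of the sum of a uniform sample from centred vectors is at most that of
independent draws. -/
lemma card_mul_sum_samples_norm_sq_le {mode : Sampling} {β N : ℕ} {X : Fin N → E}
    (hX : ∑ i, X i = 0) :
    (N : ℝ) * ∑ S ∈ (samples mode β N).toFinset, ‖∑ j, X (S j)‖ ^ 2
      ≤ β * ((samples mode β N).toFinset.card * ∑ i, ‖X i‖ ^ 2) := by
  set s := (samples mode β N).toFinset with hs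
  have hexp : ∑ S ∈ s, ‖∑ j, X (S j)‖ ^ 2 = ∑ j, ∑ l, ∑ S ∈ s, ⟪X (S j), X (S l)⟫_ℝ := by
    rw [Finset.sum_congr rfl fun j _ => Finset.sum_comm, Finset.sum_comm]
    refine Finset.sum_congr rfl fun S _ => ?_
    rw [← real_inner_self_eq_norm_sq, sum_inner]
    exact Finset.sum_congr rfl fun j _ => inner_sum _ _ _
  have hle : ∑ S ∈ s, ‖∑ j, X (S j)‖ ^ 2 ≤ ∑ j : Fin β, ∑ S ∈ s, ‖X (S j)‖ ^ 2 := by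
    rw [hexp]
    refine Finset.sum_le_sum fun j _ => ?_
    rw [← Finset.add_sum_erase _ _ (Finset.mem_univ j)]
    have : ∑ l ∈ Finset.univ.erase j, ∑ S ∈ s, ⟪X (S j), X (S l)⟫_ℝ ≤ 0 :=
      Finset.sum_nonpos fun l hl => sum_samples_inner_nonpos hX (Finset.ne_of_mem_erase hl).symm
    simp only [real_inner_self_eq_norm_sq]
    linarith
  calc _ ≤ (N : ℝ) * ∑ j : Fin β, ∑ S ∈ s, ‖X (S j)‖ ^ 2 :=
        mul_le_mul_of_nonneg_left hle (Nat.cast_nonneg N)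
    _ = ∑ j : Fin β, (s.card * ∑ i, ‖X i‖ ^ 2) := by
        rw [Finset.mul_sum]
        exact Finset.sum_congr rfl fun j _ => card_mul_sum_samples_apply (fun i => ‖X i‖ ^ 2) j
    _ = _ := by simp

open Classical in
/-- The mean norm of the sum of a uniform sample from centred vectors with second moment `v`. -/
lemma sum_samples_norm_le {mode : Sampling} {β N : ℕ} {X : Fin N → E}
    (hX : ∑ i, X i = 0) {v : ℝ} (hv : 0 ≤ v) (hN : 0 < N)
    (hvar : (N : ℝ)⁻¹ * ∑ i, ‖X i‖ ^ 2 ≤ v ^ 2) :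
    ∑ S ∈ (samples mode β N).toFinset, ‖∑ j, X (S j)‖
      ≤ (samples mode β N).toFinset.card * (√β * v) := by
  set s := (samples mode β N).toFinset with hs
  have hN' : (0 : ℝ) < N := by exact_mod_cast hN
  have h1 : ∑ S ∈ s, ‖∑ j, X (S j)‖ ^ 2 ≤ s.card * (β * v ^ 2) := by
    have h := card_mul_sum_samples_norm_sq_le (mode := mode) (β := β) hX
    rw [← le_div_iff₀' hN'] at h
    refine h.trans ?_
    rw [inv_mul_eq_div] at hvar
    calc _ = (s.card : ℝ) * (β * ((∑ i, ‖X i‖ ^ 2) / N)) := by ring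
      _ ≤ _ := by gcongr
  have h2 : (∑ S ∈ s, ‖∑ j, X (S j)‖) ^ 2 ≤ s.card * ∑ S ∈ s, ‖∑ j, X (S j)‖ ^ 2 :=
    sq_sum_le_card_mul_sum_sq
  refine le_of_sq_le_sq ?_ (by positivity)
  rw [mul_pow, mul_pow, Real.sq_sqrt (Nat.cast_nonneg β)]
  calc _ ≤ _ := h2
    _ ≤ (s.card : ℝ) * (s.card * (β * v ^ 2)) := by gcongr
    _ = _ := by ring

end SamplingVariance

/-! ### Operator bounds from the Loewner order -/

section Loewner

variable {d : ℕ} {A : Vec d →L[ℝ] Vec d} {c : ℝ}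

lemma inner_map_comm_of_smul_id_le (h : c • ContinuousLinearMap.id ℝ (Vec d) ≤ A) (x y : Vec d) :
    ⟪A x, y⟫_ℝ = ⟪x, A y⟫_ℝ := by
  have h1 := ((ContinuousLinearMap.le_def _ _).mp h).isSymmetric x y
  simpa [inner_sub_left, inner_sub_right, inner_smul_left, inner_smul_right] using h1

lemma mul_norm_sq_le_of_smul_id_le (h : c • ContinuousLinearMap.id ℝ (Vec d) ≤ A) (x : Vec d) :
    c * ‖x‖ ^ 2 ≤ ⟪x, A x⟫_ℝ := by
  have h1 := ((ContinuousLinearMap.le_def _ _).mp h).inner_nonneg_right x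
  simpa [inner_sub_right, inner_smul_right] using h1

lemma inner_map_self_le_of_le_smul_id (h : A ≤ c • ContinuousLinearMap.id ℝ (Vec d)) (x : Vec d) :
    ⟪x, A x⟫_ℝ ≤ c * ‖x‖ ^ 2 := by
  have h1 := ((ContinuousLinearMap.le_def _ _).mp h).inner_nonneg_right x
  simpa [inner_sub_right, inner_smul_right] using h1

/-- Nonnegativity of the form at `c x - A x`, with the upper bound at `x` and at `A x`, leaves `c ‖A
x‖² ≤ c³ ‖x‖²`. -/
lemma norm_map_le_of_inner_le (hA : ∀ x y, ⟪A x, y⟫_ℝ = ⟪x, A y⟫_ℝ) (hc : 0 < c)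
    (hlow : ∀ x, 0 ≤ ⟪x, A x⟫_ℝ) (hup : ∀ x, ⟪x, A x⟫_ℝ ≤ c * ‖x‖ ^ 2) (x : Vec d) :
    ‖A x‖ ≤ c * ‖x‖ := by
  have h := hlow (c • x - A x)
  have h1 : ⟪c • x - A x, A (c • x - A x)⟫_ℝ
      = c ^ 2 * ⟪x, A x⟫_ℝ - 2 * c * ‖A x‖ ^ 2 + ⟪A x, A (A x)⟫_ℝ := by
    rw [map_sub, map_smul, inner_sub_left, inner_sub_right, inner_sub_right,
      real_inner_smul_left, real_inner_smul_left, real_inner_smul_right, real_inner_smul_right,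
      ← hA x (A x), real_inner_self_eq_norm_sq]
    ring
  have h2 := mul_le_mul_of_nonneg_left (hup x) (sq_nonneg c)
  have h3 := hup (A x)
  have h4 : c * ‖A x‖ ^ 2 ≤ c * (c * ‖x‖) ^ 2 := by
    rw [h1] at h
    linarith
  exact le_of_sq_le_sq (le_of_mul_le_mul_left h4 hc) (by positivity)

lemma mul_norm_le_norm_map {m : ℝ} (hlow : ∀ x, m * ‖x‖ ^ 2 ≤ ⟪x, A x⟫_ℝ) (x : Vec d) :
    m * ‖x‖ ≤ ‖A x‖ := by
  rcases eq_or_ne x 0 with rfl | hx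
  · simp
  · have h := (hlow x).trans (real_inner_le_norm _ _)
    have hx' := norm_pos_iff.mpr hx
    refine le_of_mul_le_mul_left ?_ hx'
    linarith

lemma exists_map_eq {m : ℝ} (hm : 0 < m) (hlow : ∀ x, m * ‖x‖ ^ 2 ≤ ⟪x, A x⟫_ℝ) (b : Vec d) :
    ∃ p, A p = b := by
  have hinj : Function.Injective (A : Vec d →ₗ[ℝ] Vec d) := by
    rw [← LinearMap.ker_eq_bot, LinearMap.ker_eq_bot']
    intro x hx
    have h := mul_norm_le_norm_map hlow x
    rw [show A x = 0 from hx, norm_zero] at h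
    have h0 : ‖x‖ ≤ 0 := nonpos_of_mul_nonpos_right h hm
    exact norm_le_zero_iff.mp h0
  exact LinearMap.injective_iff_surjective.mp hinj b

end Loewner

/-! ### Taylor bounds and the error of one step -/

section Calculus

variable {d : ℕ}

/-- Taylor's bound for a vector field with Lipschitz derivative. -/
lemma norm_sub_sub_fderiv_le {g : Vec d → Vec d} (hg : Differentiable ℝ g) {M : ℝ}
    (hM : ∀ x y, ‖fderiv ℝ g x - fderiv ℝ g y‖ ≤ M * ‖x - y‖) (w z : Vec d) :
    ‖g z - g w - fderiv ℝ g w (z - w)‖ ≤ M / 2 * ‖z - w‖ ^ 2 := by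
  set v := z - w with hv
  set f : ℝ → Vec d := fun t => g (w + t • v) - g w - t • fderiv ℝ g w v with hf
  have hline : ∀ t : ℝ, HasDerivAt (fun t : ℝ => w + t • v) v t := fun t => by
    simpa using ((hasDerivAt_id t).smul_const v).const_add w
  have hderiv : ∀ t : ℝ, HasDerivAt f (fderiv ℝ g (w + t • v) v - fderiv ℝ g w v) t := fun t => by
    have h1 := (hg (w + t • v)).hasFDerivAt.comp_hasDerivAt t (hline t)
    have h2 := ((hasDerivAt_id t).smul_const (fderiv ℝ g w v))
    rw [one_smul] at h2
    exact (h1.sub_const (g w)).sub h2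
  have hB : ∀ t : ℝ, HasDerivAt (fun t : ℝ => M / 2 * ‖v‖ ^ 2 * t ^ 2) (M * ‖v‖ ^ 2 * t) t :=
    fun t => by
      have := (hasDerivAt_pow 2 t).const_mul (M / 2 * ‖v‖ ^ 2)
      refine this.congr_deriv ?_
      push_cast
      ring
  -- On the segment `‖f' t‖ ≤ M ‖v‖² t`, the derivative of `M / 2 * ‖v‖² * t²`.
  have h := image_norm_le_of_norm_deriv_right_le_deriv_boundary (a := 0) (b := 1) (f := f)
    (fun t _ => (hderiv t).continuousAt.continuousWithinAt)
    (fun t _ => (hderiv t).hasDerivWithinAt) (by simp [hf]) hB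
    (fun t ht => by
      rw [← sub_apply]
      refine (ContinuousLinearMap.le_opNorm _ _).trans ?_
      calc _ ≤ M * ‖w + t • v - w‖ * ‖v‖ :=
            mul_le_mul_of_nonneg_right (hM _ _) (norm_nonneg _)
        _ = _ := by
          rw [add_sub_cancel_left, norm_smul, Real.norm_of_nonneg ht.1]
          ring)
    (Set.right_mem_Icc.mpr zero_le_one)
  simpa [hf, hv] using h

lemma gradient_eq_zero_of_forall_le {f : Vec d → ℝ} {w : Vec d} (h : ∀ z, f w ≤ f z) :
    gradient f w = 0 := by
  have h1 : fderiv ℝ f w = 0 :=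
    IsLocalMin.fderiv_eq_zero (Filter.Eventually.of_forall h)
  rw [gradient, h1, map_zero]

variable {N : ℕ} {F : Fin N → Vec d → ℝ}

lemma gradient_risk (hF : ∀ i, Differentiable ℝ (F i)) :
    gradient (risk F) = fun w => (N : ℝ)⁻¹ • ∑ i, gradient (F i) w := by
  funext w
  have h : HasFDerivAt (risk F) ((N : ℝ)⁻¹ • ∑ i, fderiv ℝ (F i) w) w :=
    (HasFDerivAt.fun_sum fun i _ => (hF i w).hasFDerivAt).const_mul (N : ℝ)⁻¹
  rw [gradient, h.fderiv]
  simp [gradient]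

lemma hasFDerivAt_gradient_risk (hF : ∀ i, Differentiable ℝ (F i))
    (hF' : ∀ i, Differentiable ℝ (gradient (F i))) (w : Vec d) :
    HasFDerivAt (gradient (risk F)) ((N : ℝ)⁻¹ • ∑ i, hess (F i) w) w := by
  rw [gradient_risk hF]
  exact (HasFDerivAt.fun_sum fun i _ => (hF' i w).hasFDerivAt).const_smul (N : ℝ)⁻¹

lemma hess_risk (hF : ∀ i, Differentiable ℝ (F i))
    (hF' : ∀ i, Differentiable ℝ (gradient (F i))) (w : Vec d) :
    hess (risk F) w = (N : ℝ)⁻¹ • ∑ i, hess (F i) w :=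
  (hasFDerivAt_gradient_risk hF hF' w).fderiv

/-- The error after one inexact Newton step with the operator `A` in place of the Hessian. -/
lemma norm_newton_cg_sub_le {f : Vec d → ℝ} (hdiff : Differentiable ℝ (gradient f))
    {μ L M : ℝ} (hμ : 0 ≤ μ) (hL : 0 < L)
    (hlowH : ∀ w, μ • ContinuousLinearMap.id ℝ (Vec d) ≤ hess f w)
    (hupH : ∀ w, hess f w ≤ L • ContinuousLinearMap.id ℝ (Vec d))
    (hM : ∀ w z, ‖hess f w - hess f z‖ ≤ M * ‖w - z‖)
    {wstar : Vec d} (hstar : ∀ w, f wstar ≤ f w)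
    {A : Vec d →L[ℝ] Vec d} {m K : ℝ} (hm : 0 < m)
    (hlow : m • ContinuousLinearMap.id ℝ (Vec d) ≤ A)
    (hup : A ≤ K • ContinuousLinearMap.id ℝ (Vec d)) {r : ℕ} (hr : 1 ≤ r)
    (hlog : K / m ≠ 1 → Real.log (16 * L / m * √(K / m)) *
      (1 / Real.log ((√(K / m) + 1) / (√(K / m) - 1))) ≤ (r : ℝ)) (w : Vec d) :
    ‖w + cg A (-gradient f w) r - wstar‖ ≤
      m⁻¹ * ‖(A - hess f w) (w - wstar)‖ + M / (2 * m) * ‖w - wstar‖ ^ 2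
        + 1 / 8 * ‖w - wstar‖ := by
  -- In dimension zero the operator bounds do not force `m ≤ K`.
  rcases subsingleton_or_nontrivial (Vec d) with hsub | hnon
  · simp [Subsingleton.elim _ (0 : Vec d)]
  have hA := inner_map_comm_of_smul_id_le hlow
  have hlow' := mul_norm_sq_le_of_smul_id_le hlow
  have hup' := inner_map_self_le_of_le_smul_id hup
  have hmK : m ≤ K := by
    obtain ⟨x, hx⟩ := exists_ne (0 : Vec d)
    exact le_of_mul_le_mul_right ((hlow' x).trans (hup' x)) (pow_pos (norm_pos_iff.mpr hx) 2)
  have hK : 0 < K := hm.trans_le hmK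
  obtain ⟨p, hp⟩ := exists_map_eq hm hlow' (-gradient f w)
  have hstar0 := gradient_eq_zero_of_forall_le hstar
  set v := w - wstar with hv
  have hTaylor : ‖gradient f w - hess f w v‖ ≤ M / 2 * ‖v‖ ^ 2 := by
    have h := norm_sub_sub_fderiv_le hdiff hM w wstar
    rw [hstar0, norm_sub_rev wstar w] at h
    have h1 : (0 : Vec d) - gradient f w - fderiv ℝ (gradient f) w (wstar - w)
        = -(gradient f w - hess f w v) := by
      rw [hv, ← neg_sub w wstar, map_neg, hess]
      abel
    rwa [h1, norm_neg] at h
  have hgrad : ‖gradient f w‖ ≤ L * ‖v‖ := by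
    have h := Convex.norm_image_sub_le_of_norm_fderiv_le (f := gradient f) (𝕜 := ℝ) (C := L)
      (s := Set.univ) (x := wstar) (y := w) (fun x _ => hdiff x)
      (fun x _ => ContinuousLinearMap.opNorm_le_bound _ hL.le
        (norm_map_le_of_inner_le (inner_map_comm_of_smul_id_le (hlowH x)) hL
          (fun y => (mul_nonneg hμ (sq_nonneg _)).trans
            (mul_norm_sq_le_of_smul_id_le (hlowH x) y))
          (inner_map_self_le_of_le_smul_id (hupH x))))
      convex_univ (Set.mem_univ _) (Set.mem_univ _)
    rwa [hstar0, sub_zero] at h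
  have hexact : ‖w + p - wstar‖ ≤ m⁻¹ * ‖(A - hess f w) v‖ + M / (2 * m) * ‖v‖ ^ 2 := by
    have h1 : A (w + p - wstar) = (A - hess f w) v - (gradient f w - hess f w v) := by
      rw [show w + p - wstar = v + p by rw [hv]; abel, map_add, hp, sub_apply]
      abel
    have h2 := mul_norm_le_norm_map hlow' (w + p - wstar)
    rw [h1] at h2
    have h3 := h2.trans ((norm_sub_le _ _).trans (add_le_add_right hTaylor _))
    rw [← le_div_iff₀' hm] at h3
    refine h3.trans (le_of_eq ?_)
    field_simp
  have hcg : ‖cg A (-gradient f w) r - p‖ ≤ 1 / 8 * ‖v‖ := by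
    -- This `y` is chosen so that `2 / y * √(K / m) * (L / m) = 1 / 8`.
    have h := norm_sub_cg_le hA hm hmK (y := 16 * L / m * √(K / m)) (by positivity) hlow' hup'
      hr hlog hp
    have hpn : ‖p‖ ≤ L * ‖v‖ / m := by
      rw [le_div_iff₀' hm]
      refine (mul_norm_le_norm_map hlow' p).trans ?_
      rw [hp, norm_neg]
      exact hgrad
    refine h.trans ((mul_le_mul_of_nonneg_left hpn (by positivity)).trans (le_of_eq ?_))
    have hs : 0 < √(K / m) := by positivity
    field_simp
    ring
  calc ‖w + cg A (-gradient f w) r - wstar‖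
      = ‖(w + p - wstar) + (cg A (-gradient f w) r - p)‖ := by congr 1; abel
    _ ≤ _ := (norm_add_le _ _).trans (add_le_add hexact hcg)

open Classical in
/-- The mean error of the subsampled Hessian along a direction. -/
lemma sum_samples_norm_sampleHess_sub_le {mode : Sampling} {β : ℕ} (hβ : 1 ≤ β) (hN : 0 < N)
    (hF : ∀ i, Differentiable ℝ (F i)) (hF' : ∀ i, Differentiable ℝ (gradient (F i)))
    {w : Vec d} (hsymm : ∀ i x y, ⟪hess (F i) w x, y⟫_ℝ = ⟪x, hess (F i) w y⟫_ℝ)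
    {σ : ℝ} (hvar : BoundedHessianVariance F σ) {m : ℝ} (hm : 0 < m)
    (hβσ : 64 * σ ^ 2 / m ^ 2 ≤ β) (v : Vec d) :
    ∑ S ∈ (samples mode β N).toFinset, ‖(sampleHess F S w - hess (risk F) w) v‖
      ≤ (samples mode β N).toFinset.card * (m / 8 * ‖v‖) := by
  set s := (samples mode β N).toFinset
  have hN' : (N : ℝ) ≠ 0 := by exact_mod_cast hN.ne'
  have hβ' : (0 : ℝ) < β := by exact_mod_cast hβ
  set H := hess (risk F) w with hH
  have hmean : H = (N : ℝ)⁻¹ • ∑ i, hess (F i) w := hess_risk hF hF' w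
  -- The direction `v` does not depend on the sample, so a variance bound for vectors replaces
  -- matrix concentration.
  set X : Fin N → Vec d := fun i => (hess (F i) w - H) v with hX
  have hHsymm : ∀ x y, ⟪H x, y⟫_ℝ = ⟪x, H y⟫_ℝ := fun x y => by
    rw [hmean]
    simp only [smul_apply, sum_apply, real_inner_smul_left,
      real_inner_smul_right, sum_inner, inner_sum, hsymm]
  have hX0 : ∑ i, X i = 0 := by
    have h1 : ∑ i, hess (F i) w v = (N : ℝ) • H v := by
      rw [hmean, smul_apply, smul_inv_smul₀ hN', sum_apply]
    simp [hX, h1, ← Nat.cast_smul_eq_nsmul ℝ]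
  have hXvar : (N : ℝ)⁻¹ * ∑ i, ‖X i‖ ^ 2 ≤ (|σ| * ‖v‖) ^ 2 := by
    have h1 : ∀ i, ‖X i‖ ^ 2 = ⟪v, ((hess (F i) w - H) ^ 2) v⟫_ℝ := fun i => by
      -- Symmetry of the Hessians turns the squared norm into the quadratic form of the squared
      -- operator.
      rw [pow_two (hess (F i) w - H), mul_apply_eq_comp, ← real_inner_self_eq_norm_sq]
      simp only [hX, sub_apply, inner_sub_left, inner_sub_right, map_sub, hsymm, hHsymm]
    have h2 : (N : ℝ)⁻¹ * ∑ i, ‖X i‖ ^ 2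
        = ⟪v, ((N : ℝ)⁻¹ • ∑ i, (hess (F i) w - H) ^ 2) v⟫_ℝ := by
      simp only [h1, smul_apply, sum_apply, real_inner_smul_right, inner_sum]
    rw [h2, mul_pow, sq_abs]
    calc _ ≤ ‖v‖ * (σ ^ 2 * ‖v‖) :=
          (real_inner_le_norm _ _).trans (mul_le_mul_of_nonneg_left
            ((ContinuousLinearMap.le_opNorm _ _).trans
              (mul_le_mul_of_nonneg_right (hvar w) (norm_nonneg _))) (norm_nonneg _))
      _ = _ := by ring
  have hsum := sum_samples_norm_le (mode := mode) (β := β) hX0 (by positivity) hN hXvar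
  have hS : ∀ S : Fin β → Fin N, ‖(sampleHess F S w - H) v‖ = (β : ℝ)⁻¹ * ‖∑ j, X (S j)‖ := by
    intro S
    rw [← Real.norm_of_nonneg (inv_nonneg.mpr hβ'.le), ← norm_smul]
    congr 1
    simp [hX, sampleHess, smul_sub, ← Nat.cast_smul_eq_nsmul ℝ, inv_smul_smul₀ hβ'.ne']
  -- The constant 64 in the condition on `β` is the square of this 8.
  have hσ : |σ| ≤ √β * m / 8 := by
    refine le_of_sq_le_sq ?_ (by positivity)
    rw [div_le_iff₀ (by positivity)] at hβσ
    rw [sq_abs, div_pow, mul_pow, Real.sq_sqrt hβ'.le]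
    linarith
  rw [Finset.sum_congr rfl fun S _ => hS S, ← Finset.mul_sum]
  calc _ ≤ (β : ℝ)⁻¹ * (s.card * (√β * (√β * m / 8 * ‖v‖))) := by
        refine mul_le_mul_of_nonneg_left (hsum.trans ?_) (inv_nonneg.mpr hβ'.le)
        gcongr
    _ = (β : ℝ)⁻¹ * (√β * √β) * (s.card * (m / 8 * ‖v‖)) := by ring
    _ = _ := by rw [Real.mul_self_sqrt hβ'.le, inv_mul_cancel₀ hβ'.ne', one_mul]

end Calculus

/-! ### Expectations over finitely valued variables -/

section Probability

lemma integrable_comp_of_finite {Ω α : Type*} [MeasurableSpace Ω] {P : Measure Ω}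
    [IsFiniteMeasure P] [Finite α] [MeasurableSpace α] [MeasurableSingletonClass α]
    {T : Ω → α} (hT : Measurable T) (g : α → ℝ) : Integrable (fun ω => g (T ω)) P :=
  (Integrable.of_finite (μ := P.map T) (f := g)).comp_measurable hT

open Classical in
lemma integral_uniformOn {α : Type*} [Fintype α] [MeasurableSpace α] [MeasurableSingletonClass α]
    (s : Set α) (g : α → ℝ) :
    ∫ x, g x ∂(uniformOn s) = (s.toFinset.card : ℝ)⁻¹ * ∑ x ∈ s.toFinset, g x := by
  have hs : (s.toFinset : Set α) = s := Set.coe_toFinset s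
  have hcount : Measure.count s = s.toFinset.card := by
    rw [← Measure.count_apply_finset, hs]
  have h : ∫ x in s, g x ∂Measure.count = ∑ x ∈ s.toFinset, g x := by
    conv_lhs => rw [← hs]
    rw [setIntegral_finset (hf := Integrable.of_finite.integrableOn)]
    simp [Measure.real]
  rw [uniformOn, ProbabilityTheory.cond, integral_smul_measure, h, hcount]
  simp

open Classical in
/-- Averaging over an independent uniform variable. -/
lemma integral_le_of_sum_uniform_le {Ω α U : Type*} [MeasurableSpace Ω] {P : Measure Ω}
    [IsProbabilityMeasure P] [Finite α] [MeasurableSpace α] [MeasurableSingletonClass α]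
    [Fintype U] [MeasurableSpace U] [MeasurableSingletonClass U] {T : Ω → α} {V : Ω → U}
    (hT : Measurable T) (hV : Measurable V) (hindep : IndepFun T V P) {s : Set U}
    (hlaw : P.map V = uniformOn s) {h : α → U → ℝ} {g : α → ℝ}
    (hle : ∀ t, ∑ u ∈ s.toFinset, h t u ≤ s.toFinset.card * g t) :
    ∫ ω, h (T ω) (V ω) ∂P ≤ ∫ ω, g (T ω) ∂P := by
  have hprob : IsProbabilityMeasure (P.map V) := Measure.isProbabilityMeasure_map hV.aemeasurable
  have hprobT : IsProbabilityMeasure (P.map T) := Measure.isProbabilityMeasure_map hT.aemeasurable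
  -- The uniform law on the empty set is zero, hence not the law of `V`.
  have hs : (0 : ℝ) < s.toFinset.card := by
    rw [Nat.cast_pos, Finset.card_pos, Set.toFinset_nonempty, Set.nonempty_iff_ne_empty]
    rintro rfl
    rw [uniformOn_empty_meas] at hlaw
    exact hprob.ne_zero _ hlaw
  have h1 : ∫ ω, h (T ω) (V ω) ∂P = ∫ z, h z.1 z.2 ∂((P.map T).prod (P.map V)) := by
    rw [← (indepFun_iff_map_prod_eq_prod_map_map hT.aemeasurable hV.aemeasurable).mp hindep,
      integral_map (hT.prodMk hV).aemeasurable
        (Integrable.of_finite (f := fun z : α × U => h z.1 z.2)).aestronglyMeasurable]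
  have h2 : ∫ ω, g (T ω) ∂P = ∫ t, g t ∂(P.map T) :=
    (integral_map hT.aemeasurable (Integrable.of_finite (f := g)).aestronglyMeasurable).symm
  rw [h1, h2, integral_prod _ Integrable.of_finite]
  refine integral_mono Integrable.of_finite Integrable.of_finite fun t => ?_
  simp only [hlaw]
  rw [integral_uniformOn, inv_mul_le_iff₀ hs]
  exact hle t

end Probability

/-! ### The iterates as random variables and the recursion -/

lemma newtonCG_congr {d N β : ℕ} {F : Fin N → Vec d → ℝ} {r : ℕ} {w₀ : Vec d}
    {S S' : ℕ → Fin β → Fin N} {k : ℕ} (h : ∀ j < k, S j = S' j) :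
    newtonCG F r w₀ S k = newtonCG F r w₀ S' k := by
  induction k with
  | zero => rfl
  | succ k ih =>
    rw [newtonCG, newtonCG, ih fun j hj => h j (hj.trans k.lt_succ_self), h k k.lt_succ_self]

/-- Every single Hessian is symmetric when the Hessians of all samples of size one are. -/
lemma BoundedHessians.hess_symm {d N : ℕ} {F : Fin N → Vec d → ℝ} {mode : Sampling}
    {μs Ls : ℕ → ℝ} {μbar Lbar μ L : ℝ} (h : BoundedHessians F mode μs Ls μbar Lbar μ L)
    (w : Vec d) (i : Fin N) (x y : Vec d) :
    ⟪hess (F i) w x, y⟫_ℝ = ⟪x, hess (F i) w y⟫_ℝ := by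
  have hmem : (fun _ => i) ∈ samples mode 1 N := by
    cases mode
    · trivial
    · exact Function.injective_of_subsingleton _
  have h1 := h.le_sampleHess 1 le_rfl _ hmem w
  have h2 : sampleHess F (fun _ : Fin 1 => i) w = hess (F i) w := by simp [sampleHess]
  rw [h2] at h1
  exact inner_map_comm_of_smul_id_le h1 x y

end SubsampledNewton

open SubsampledNewton in
theorem theorem3p2 {d N : ℕ} (F : Fin N → SubsampledNewton.Vec d → ℝ)
    (mode : SubsampledNewton.Sampling)
    (μs Ls : ℕ → ℝ) (μbar Lbar μ L M σ γ : ℝ)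
    (hA1 : SubsampledNewton.BoundedHessians F mode μs Ls μbar Lbar μ L)
    (hA3 : SubsampledNewton.LipschitzHessian (SubsampledNewton.risk F) M)
    (hA4 : SubsampledNewton.BoundedHessianVariance F σ)
    (wstar : SubsampledNewton.Vec d)
    (hwstar : ∀ w, SubsampledNewton.risk F wstar ≤ SubsampledNewton.risk F w)
    (β : ℕ) (hβ_pos : 1 ≤ β) (hβ : 64 * σ ^ 2 / μbar ^ 2 ≤ (β : ℝ))
    (δ : ℝ) (hδ : δ = Ls β / μs β)
    (r : ℕ) (hr_pos : 1 ≤ r)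
    (hr : δ ≠ 1 →
      Real.log (16 * L / μs β * √δ) * (1 / Real.log ((√δ + 1) / (√δ - 1))) ≤ (r : ℝ))
    {Ω : Type*} [MeasurableSpace Ω] (P : Measure Ω) [IsProbabilityMeasure P]
    (S : ℕ → Ω → Fin β → Fin N) (hS : SubsampledNewton.IsSampleSequence P mode S)
    (w₀ : SubsampledNewton.Vec d)
    (w : ℕ → Ω → SubsampledNewton.Vec d)
    (hw : ∀ k ω, w k ω = SubsampledNewton.newtonCG F r w₀ (fun j => S j ω) k)
    (hB1 : SubsampledNewton.BoundedMoments P w wstar γ)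
    (C₁ : ℝ) (hC₁ : C₁ = M / (2 * μs β))
    (hw₀ : ‖w₀ - wstar‖ ≤ min (1 / (4 * C₁)) (1 / (4 * γ * C₁))) :
    (∀ k, Integrable (fun ω => ‖w k ω - wstar‖) P) ∧
      ∀ k, ∫ ω, ‖w (k + 1) ω - wstar‖ ∂P ≤ 1 / 2 * ∫ ω, ‖w k ω - wstar‖ ∂P := by
  classical
  subst hδ
  have hm : 0 < μs β := (hA1.pos β hβ_pos).1
  have hC₁pos : 0 < C₁ := by
    rw [hC₁]
    exact div_pos hA3.1 (by linarith)
  have hγ := hB1.1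
  obtain ⟨ω₀⟩ : Nonempty Ω := nonempty_of_isProbabilityMeasure P
  have hN : 0 < N := (Nat.zero_le _).trans_lt (S 0 ω₀ ⟨0, hβ_pos⟩).isLt
  -- The mean error after one step from a deterministic point.
  have hstep : ∀ z : Vec d, ∑ u ∈ (samples mode β N).toFinset,
      ‖z + cg (sampleHess F u z) (-gradient (risk F) z) r - wstar‖
        ≤ (samples mode β N).toFinset.card * (C₁ * ‖z - wstar‖ ^ 2 + 1 / 4 * ‖z - wstar‖) := by
    intro z
    have hdiff : Differentiable ℝ (gradient (risk F)) := fun x =>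
      (hasFDerivAt_gradient_risk hA1.differentiable
        hA1.differentiable_gradient x).differentiableAt
    have hone := fun u (hu : u ∈ (samples mode β N).toFinset) =>
      norm_newton_cg_sub_le hdiff hA1.μ_pos.le hA1.L_pos hA1.le_hess hA1.hess_le hA3.2 hwstar hm
        (hA1.le_sampleHess β hβ_pos u (Set.mem_toFinset.mp hu) z)
        (hA1.sampleHess_le β hβ_pos u (Set.mem_toFinset.mp hu) z) hr_pos hr z
    have hsum := sum_samples_norm_sampleHess_sub_le (mode := mode) hβ_pos hN hA1.differentiable
      hA1.differentiable_gradient (hA1.hess_symm z) hA4 hA1.μbar_pos hβ (z - wstar)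
    have hratio : (μs β)⁻¹ * (μbar / 8 * ‖z - wstar‖) ≤ 1 / 8 * ‖z - wstar‖ := by
      rw [inv_mul_le_iff₀ hm]
      have := mul_le_mul_of_nonneg_right (hA1.μbar_le β hβ_pos) (norm_nonneg (z - wstar))
      linarith
    refine (Finset.sum_le_sum hone).trans ?_
    rw [Finset.sum_add_distrib, Finset.sum_add_distrib, ← Finset.mul_sum, Finset.sum_const,
      Finset.sum_const, nsmul_eq_mul, nsmul_eq_mul, ← hC₁]
    have h1 := mul_le_mul_of_nonneg_left hsum (inv_nonneg.mpr hm.le)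
    have h2 := mul_le_mul_of_nonneg_left hratio
      (Nat.cast_nonneg (α := ℝ) (samples mode β N).toFinset.card)
    linarith
  -- The iterates are functions of the past samples.
  let G : (k : ℕ) → (Finset.range k → Fin β → Fin N) → Vec d := fun k t =>
    -- The values at `j ≥ k` are arbitrary, since the `k`-th iterate does not read them.
    newtonCG F r w₀ (fun j => if h : j ∈ Finset.range k then t ⟨j, h⟩ else S j ω₀) k
  let T : (k : ℕ) → Ω → Finset.range k → Fin β → Fin N := fun k ω i => S i ω
  have hT : ∀ k, Measurable (T k) := fun k => measurable_pi_lambda _ fun i => hS.measurable i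
  have hG : ∀ k ω, w k ω = G k (T k ω) := fun k ω => by
    rw [hw]
    refine newtonCG_congr fun j hj => ?_
    simp [T, hj]
  -- The past samples take finitely many values, so no measurability in `w` or a priori bound is
  -- needed.
  have hint : ∀ k, Integrable (fun ω => ‖w k ω - wstar‖) P := fun k => by
    simp only [hG]
    exact integrable_comp_of_finite (hT k) fun t => ‖G k t - wstar‖
  have hint2 : ∀ k, Integrable (fun ω => ‖w k ω - wstar‖ ^ 2) P := fun k => by
    simp only [hG]
    exact integrable_comp_of_finite (hT k) fun t => ‖G k t - wstar‖ ^ 2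
  have hrec : ∀ k, ∫ ω, ‖w (k + 1) ω - wstar‖ ∂P
      ≤ C₁ * γ * (∫ ω, ‖w k ω - wstar‖ ∂P) ^ 2 + 1 / 4 * ∫ ω, ‖w k ω - wstar‖ ∂P := by
    intro k
    -- The iterate `w k` uses only samples with index below `k`, so `S k` is fresh.
    have hindep : IndepFun (T k) (S k) P := by
      have h := hS.indep.indepFun_finset (Finset.range k) {k} (by simp) hS.measurable
      exact h.comp measurable_id (measurable_pi_apply (⟨k, Finset.mem_singleton_self k⟩ :
        ({k} : Finset ℕ)))
    have h1 : ∀ ω, ‖w (k + 1) ω - wstar‖ = ‖G k (T k ω)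
        + cg (sampleHess F (S k ω) (G k (T k ω))) (-gradient (risk F) (G k (T k ω))) r
          - wstar‖ := fun ω => by
      rw [← hG, hw, hw]
      rfl
    have h2 := integral_le_of_sum_uniform_le (hT k) (hS.measurable k) hindep (hS.law k)
      (h := fun t u => ‖G k t + cg (sampleHess F u (G k t)) (-gradient (risk F) (G k t)) r
        - wstar‖) fun t => hstep (G k t)
    rw [← integral_congr_ae (.of_forall h1)] at h2
    simp only [← hG] at h2
    rw [integral_add ((hint2 k).const_mul _) ((hint k).const_mul _), integral_const_mul,
      integral_const_mul] at h2
    have h3 := mul_le_mul_of_nonneg_left (hB1.2 k) hC₁pos.le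
    linarith
  have hhalf : ∀ k, ∫ ω, ‖w k ω - wstar‖ ∂P ≤ 1 / (4 * γ * C₁) →
      ∫ ω, ‖w (k + 1) ω - wstar‖ ∂P ≤ 1 / 2 * ∫ ω, ‖w k ω - wstar‖ ∂P := by
    intro k hk
    have hnn : 0 ≤ ∫ ω, ‖w k ω - wstar‖ ∂P := integral_nonneg fun ω => norm_nonneg _
    rw [le_div_iff₀ (by positivity)] at hk
    have h1 := mul_le_mul_of_nonneg_right hk hnn
    have h2 := hrec k
    linarith
  have hsmall : ∀ k, ∫ ω, ‖w k ω - wstar‖ ∂P ≤ 1 / (4 * γ * C₁) := by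
    intro k
    induction k with
    | zero =>
      simp only [hw, newtonCG, integral_const, probReal_univ, one_smul]
      exact hw₀.trans (min_le_right _ _)
    | succ k ih =>
      have hnn : 0 ≤ ∫ ω, ‖w k ω - wstar‖ ∂P := integral_nonneg fun ω => norm_nonneg _
      have := hhalf k ih
      linarith
  exact ⟨hint, fun k => hhalf k (hsmall k)⟩
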